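/- Let $1\le k\le d$ be integers. For an odd prime power $q$, fix a non-trivial additive character $\chi$ of $\mathbb F_q$, and for $E\subseteq\mathbb F_q^d$ write $$\widehat E(x)=q^{-d}\sum_{y\in E}\chi(-x\cdot y),\qquad \|\widehat E\|_4=\Big(q^{-d}\sum_{x\in\mathbb F_q^d\setminus\{0\}}|\widehat E(x)|^4\Big)^{1/4}.$$ For $s\in[0,1]$ and $K>0$, say that $E$ is $(4,s)$-Salem with constant $K$ if $\|\widehat E\|_4\le K\,q^{-d}(\#E)^{1-s}$. A $k$-simplex in $E$ is an ordered $(k+1)$-tuple $(x_1,\dots,x_{k+1})$ of (not necessarily distinct or affinely independent) points of $E$. Two $k$-simplices $(x_i)$ and $(y_i)$ are congruent if there are an orthogonal matrix $M\in O_d(\mathbb F_q)$ and $z\in\mathbb F_q^d$ with $Mx_i+z=y_i$ for all $i=1,\dots,k+1$. Let $T_k^d(E)$ be the set of congruence classes of $k$-simplices in $E$. (1) For every $s\in[0,1]$ and $K>0$ there is $c>0$ such that for every odd prime power $q$, every non-trivial $\chi$ and every non-empty $E\subseteq\mathbb F_q^d$ that is $(4,s)$-Salem with constant $K$, $$\#T_k^d(E)\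 \ge\ c\,\min\Big\{q^{\binom{k+1}{2}},\ (\#E)^{k-1+4s}\,q^{\binom{k+1}{2}-kd}\Big\}.$$ (2) In particular, for every $a>0$ and $K>0$ there is $c>0$ such that for every odd prime power $q$, every non-trivial $\chi$ and every $E\subseteq\mathbb F_q^d$ with $\#E\ge a\,q^{kd/(k+1)}$ that is $(4,1/2)$-Salem with constant $K$, $$\#T_k^d(E)\ \ge\ c\,q^{\binom{k+1}{2}}.$$ -/

import Mathlib

universe u

namespace FiniteFieldFourier

open Finset

/-- The Fourier transform of (the indicator function of) a set `E ⊆ F^d` with respect to the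
additive character `χ`, namely `x ↦ q^{-d} ∑_{y ∈ E} χ(-x·y)` with `q = #F`. -/
noncomputable def setFourier {F : Type*} [Field F] [Fintype F] {d : ℕ} (χ : AddChar F ℂ)
    (E : Finset (Fin d → F)) (x : Fin d → F) : ℂ :=
  ((Fintype.card F : ℂ) ^ d)⁻¹ * ∑ y ∈ E, χ (-(x ⬝ᵥ y))

/-- The averaged `L^p` norm (`1 ≤ p < ∞`) of the Fourier transform of `E`, the frequency `0`
being left out: `(q^{-d} ∑_{x ≠ 0} |Ê(x)|^p)^{1/p}`. -/
noncomputable def fourierNorm {F : Type*} [Field F] [Fintype F] [DecidableEq F] {d : ℕ}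
    (χ : AddChar F ℂ) (p : ℝ) (E : Finset (Fin d → F)) : ℝ :=
  (((Fintype.card F : ℝ) ^ d)⁻¹ *
    ∑ x ∈ univ.filter (fun x : Fin d → F => x ≠ 0), ‖setFourier χ E x‖ ^ p) ^ (1 / p)

/-- `E` satisfies the `(p, s)`-Salem bound with constant `K`. A family of sets (over varying
finite fields) is `(p, s)`-Salem when its members satisfy this with one common `K`. -/
def IsSalemWith {F : Type*} [Field F] [Fintype F] [DecidableEq F] {d : ℕ}
    (χ : AddChar F ℂ) (p s K : ℝ) (E : Finset (Fin d → F)) : Prop :=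
  fourierNorm χ p E ≤ K * (((Fintype.card F : ℝ) ^ d)⁻¹ * (#E : ℝ) ^ (1 - s))

/-- Two `k`-simplices, given by their ordered lists of `k + 1` vertices in `F^d`, are congruent
if a map `v ↦ M v + z` with `M` in the orthogonal group `O_d(F)` and `z ∈ F^d` takes the `i`-th
vertex of the first to the `i`-th vertex of the second, for every `i`. -/
def Congruent {F : Type*} [Field F] {d k : ℕ} (x y : Fin (k + 1) → Fin d → F) : Prop :=
  ∃ M ∈ Matrix.orthogonalGroup (Fin d) F, ∃ z : Fin d → F, ∀ i, M.mulVec (x i) + z = y i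

theorem congruent_equivalence (F : Type*) [Field F] (d k : ℕ) :
    Equivalence (Congruent (F := F) (d := d) (k := k)) where
  refl x := ⟨1, one_mem _, 0, fun i => by simp⟩
  symm := by
    rintro x y ⟨M, hM, z, h⟩
    have h1 := (Matrix.mem_orthogonalGroup_iff' _ _).1 hM
    refine ⟨M.transpose, ?_, -(M.transpose.mulVec z), fun i => ?_⟩
    · exact (Matrix.mem_orthogonalGroup_iff _ _).2 (by rw [Matrix.transpose_transpose]; exact h1)
    · rw [← h i, Matrix.mulVec_add, Matrix.mulVec_mulVec, h1, Matrix.one_mulVec]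
      abel
  trans := by
    rintro x y w ⟨M, hM, z, h⟩ ⟨N, hN, z', h'⟩
    refine ⟨N * M, mul_mem hN hM, N.mulVec z + z', fun i => ?_⟩
    rw [← h' i, ← h i, Matrix.mulVec_add, Matrix.mulVec_mulVec]
    abel

/-- Congruence as a setoid on the `k`-simplices of `F^d`. -/
def congruentSetoid (F : Type*) [Field F] (d k : ℕ) : Setoid (Fin (k + 1) → Fin d → F) :=
  ⟨Congruent, congruent_equivalence F d k⟩

/-- The set of congruence classes of `k`-simplices with all `k + 1` vertices in `E`.
A `k`-simplex is any ordered `(k + 1)`-tuple of points, not necessarily distinct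
or affinely independent. -/
def simplexClasses {F : Type*} [Field F] {d : ℕ} (k : ℕ) (E : Finset (Fin d → F)) :
    Set (Quotient (congruentSetoid F d k)) :=
  Quotient.mk (congruentSetoid F d k) '' {x | ∀ i, x i ∈ E}

end FiniteFieldFourier

namespace FiniteFieldFourier

open Finset Module ComplexConjugate

/-! Write `N = #E`. Cauchy–Schwarz over congruence classes reduces the claim to an upper bound for
the number `P` of congruent pairs of simplices (`sq_card_le_ncard_simplexClasses_mul`). The
isometries carrying one simplex to a congruent one are at least as many as the orthogonal matrices
fixing its direction space, of dimension at most `k`. Quadric counts show that such a stabiliser has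
at least `2^(-k) q^(C(k+1,2) - kd) |O_d|` elements. Double counting then bounds `P` by the
`(k+1)`-st moments of `ν(M, z) = #{v ∈ E : Mv + z ∈ E}` (`card_congruent_mul_le`). For each single
`M`, the Fourier transform of `ν(M, ·)` at `ξ` is, up to scaling, `Ê(ξ)` times the conjugate of
`Ê(Mᵀξ)`. By Plancherel its variance about the mean `N²/q^d` is controlled by the fourth moment of
`Ê` off zero (`sum_sq_isometryCount_sub_le`), which the Salem bound supplies. The mean yields the
term `q^C(k+1,2)` of the minimum, the variance the other. -/

/-! ### Dot products and points on quadrics -/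

theorem finrank_dotProduct_orthogonal {F : Type*} [Field F] {d : ℕ}
    (V : Submodule F (Fin d → F)) :
    finrank F V + finrank F (LinearMap.BilinForm.orthogonal (dotProductBilin F F) V) = d := by
  have hB : (dotProductBilin F F : LinearMap.BilinForm F (Fin d → F)).Nondegenerate := by
    refine ⟨fun x hx => ?_, fun x hx => ?_⟩
    · exact (dotProduct_eq_zero_iff).1 (fun w => hx w)
    · exact (dotProduct_eq_zero_iff).1 (fun w => by rw [dotProduct_comm]; exact hx w)
  have h := LinearMap.BilinForm.finrank_orthogonal hB V
  have h2 := V.finrank_le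
  rw [finrank_fin_fun] at h h2
  omega

theorem exists_dotProduct_ne_zero_of_notMem {F : Type*} [Field F] {d : ℕ}
    {V : Submodule F (Fin d → F)} {x : Fin d → F} (hx : x ∉ V) :
    ∃ y : Fin d → F, (∀ v ∈ V, v ⬝ᵥ y = 0) ∧ x ⬝ᵥ y ≠ 0 := by
  obtain ⟨f, hf, hV⟩ := Submodule.exists_le_ker_of_notMem hx
  obtain ⟨y, rfl⟩ := (dotProductEquiv F (Fin d)).surjective f
  refine ⟨y, fun v hv => ?_, ?_⟩
  · have := hV hv
    rw [dotProduct_comm]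
    simpa using this
  · rw [dotProduct_comm]
    simpa using hf

/-- A quadratic polynomial in one variable that is not identically zero has at most two roots. -/
theorem card_quadratic_roots_le {F : Type*} [Field F] [Fintype F] [DecidableEq F]
    {a b c : F} (h : a ≠ 0 ∨ b ≠ 0) :
    #{t : F | a * t ^ 2 + b * t + c = 0} ≤ 2 := by
  open Polynomial in
  set p : F[X] := C a * X ^ 2 + C b * X + C c with hp
  have hp0 : p ≠ 0 := by
    intro h0
    have h1 : p.coeff 1 = b := by simp [hp, Polynomial.coeff_C]
    have h2 : p.coeff 2 = a := by simp [hp]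
    rw [h0] at h1 h2
    simp at h1 h2
    grind
  calc #{t : F | a * t ^ 2 + b * t + c = 0} ≤ #p.roots.toFinset := by
        refine card_le_card fun t ht => ?_
        simp only [mem_filter, mem_univ, true_and] at ht
        rw [Multiset.mem_toFinset, Polynomial.mem_roots hp0]
        simp [hp, Polynomial.IsRoot, ht]
    _ ≤ p.roots.card := Multiset.toFinset_card_le _
    _ ≤ p.natDegree := p.card_roots'
    _ ≤ 2 := Polynomial.natDegree_quadratic_le

open scoped Classical in
/-- The points `y` of `F^d` having the same inner products with a subspace `V` and with themselves
as a given point outside `V` lie on a nontrivial quadric of an affine subspace of codimension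
`finrank V`. -/
theorem card_same_dotProducts_le {F : Type*} [Field F] [Fintype F] (h2 : (2 : F) ≠ 0) {d : ℕ}
    {V : Submodule F (Fin d → F)} {x : Fin d → F} (hx : x ∉ V) :
    #{y : Fin d → F | (∀ v ∈ V, v ⬝ᵥ y = v ⬝ᵥ x) ∧ y ⬝ᵥ y = x ⬝ᵥ x} *
      Fintype.card F ^ (finrank F V + 1) ≤ 2 * Fintype.card F ^ d := by
  set W := LinearMap.BilinForm.orthogonal (dotProductBilin F F) V with hW
  have memW : ∀ y, y ∈ W ↔ ∀ v ∈ V, v ⬝ᵥ y = 0 := fun y => by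
    rw [hW, LinearMap.BilinForm.mem_orthogonal_iff]; rfl
  set S : Finset (Fin d → F) := {y | y ∈ W ∧ y ⬝ᵥ y + 2 * (x ⬝ᵥ y) = 0} with hS
  have hcard : #{y : Fin d → F | (∀ v ∈ V, v ⬝ᵥ y = v ⬝ᵥ x) ∧ y ⬝ᵥ y = x ⬝ᵥ x} ≤ #S := by
    refine card_le_card_of_injOn (fun y => y - x) (fun y hy => ?_)
      (fun a _ b _ hab => sub_left_injective hab)
    simp only [coe_filter, mem_univ, true_and, Set.mem_ofPred_eq] at hy
    simp only [hS, coe_filter, mem_univ, true_and, Set.mem_ofPred_eq, memW]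
    refine ⟨fun v hv => by rw [dotProduct_sub, hy.1 v hv, sub_self], ?_⟩
    rw [dotProduct_sub, sub_dotProduct, sub_dotProduct, dotProduct_sub, hy.2, dotProduct_comm y x]
    ring
  -- A direction along which the equation of `S` is nonconstant on every line. If the form vanishes
  -- on `W`, polarization kills `2 * (y ⬝ᵥ y0)`, and `x ∉ V` provides `y0` with `x ⬝ᵥ y0 ≠ 0`.
  have hy0 : ∃ y0 ∈ W, ∀ y ∈ W, y0 ⬝ᵥ y0 ≠ 0 ∨ 2 * (y ⬝ᵥ y0) + 2 * (x ⬝ᵥ y0) ≠ 0 := by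
    by_cases hQ : ∃ y0 ∈ W, y0 ⬝ᵥ y0 ≠ 0
    · obtain ⟨y0, h0, h1⟩ := hQ
      exact ⟨y0, h0, fun _ _ => Or.inl h1⟩
    · push Not at hQ
      obtain ⟨y0, hV, h0⟩ := exists_dotProduct_ne_zero_of_notMem hx
      refine ⟨y0, (memW _).2 hV, fun y hy => Or.inr ?_⟩
      have e1 := hQ (y + y0) (add_mem hy ((memW _).2 hV))
      rw [dotProduct_add, add_dotProduct, add_dotProduct, hQ y hy, hQ y0 ((memW _).2 hV),
        dotProduct_comm y0 y] at e1
      have e2 : 2 * (y ⬝ᵥ y0) = 0 := by linear_combination e1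
      rw [e2, zero_add]
      exact mul_ne_zero h2 h0
  obtain ⟨y0, hy0W, hy0⟩ := hy0
  -- The fibre over `z` of `(p, t) ↦ p + t • y0` consists of the roots `t` of the equation of `S` at
  -- `z - t • y0`.
  have hlines : #(S ×ˢ (univ : Finset F)) ≤ 2 * #{y : Fin d → F | y ∈ W} := by
    refine card_le_mul_card_image_of_maps_to (f := fun p => p.1 + p.2 • y0) (fun p hp => ?_) 2
      (fun z hz => ?_)
    · simp only [mem_product, hS, mem_filter, mem_univ, true_and, and_true] at hp ⊢
      exact add_mem hp.1 (W.smul_mem _ hy0W)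
    · simp only [mem_filter, mem_univ, true_and] at hz
      refine le_trans (card_le_card_of_injOn Prod.snd (fun p hp => ?_) (fun p hp p' hp' h => ?_))
        (card_quadratic_roots_le (a := y0 ⬝ᵥ y0) (b := -(2 * (z ⬝ᵥ y0) + 2 * (x ⬝ᵥ y0)))
          (c := z ⬝ᵥ z + 2 * (x ⬝ᵥ z)) ((hy0 z hz).imp_right neg_ne_zero.2))
      · simp only [coe_filter, mem_product, hS, mem_filter, mem_univ, true_and, and_true,
          Set.mem_ofPred_eq] at hp ⊢
        obtain ⟨⟨-, hp1⟩, rfl⟩ := hp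
        rw [← hp1]
        simp only [dotProduct_add, add_dotProduct, dotProduct_smul, smul_dotProduct, smul_eq_mul,
          dotProduct_comm y0 p.1]
        ring
      · simp only [coe_filter, Set.mem_ofPred_eq] at hp hp'
        refine Prod.ext ?_ h
        have := hp.2.trans hp'.2.symm
        rw [h] at this
        exact add_right_cancel this
  have hWcard : #{y : Fin d → F | y ∈ W} = Fintype.card F ^ finrank F W := by
    rw [← Module.card_eq_pow_finrank (K := F) (V := W), Fintype.card_subtype]
  rw [card_product, card_univ, hWcard] at hlines
  have hd := finrank_dotProduct_orthogonal V
  rw [← hW] at hd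
  calc _ ≤ #S * Fintype.card F ^ (finrank F V + 1) := by gcongr
    _ = #S * Fintype.card F * Fintype.card F ^ finrank F V := by ring
    _ ≤ 2 * Fintype.card F ^ finrank F W * Fintype.card F ^ finrank F V := by gcongr
    _ = 2 * Fintype.card F ^ d := by
      rw [mul_assoc, ← pow_add, add_comm (finrank F W), hd]

/-! ### Pointwise stabilisers in the orthogonal group -/

open scoped Classical in
/-- The orthogonal group as a finite set of matrices. -/
noncomputable def orthogonalFinset (F : Type*) [Field F] [Fintype F] (d : ℕ) :
    Finset (Matrix (Fin d) (Fin d) F) :=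
  {M | M ∈ Matrix.orthogonalGroup (Fin d) F}

theorem mem_orthogonalFinset {F : Type*} [Field F] [Fintype F] {d : ℕ}
    {M : Matrix (Fin d) (Fin d) F} :
    M ∈ orthogonalFinset F d ↔ M ∈ Matrix.orthogonalGroup (Fin d) F := by
  simp [orthogonalFinset]

theorem dotProduct_mulVec_mulVec_of_mem_orthogonalGroup {F : Type*} [Field F] {d : ℕ}
    {M : Matrix (Fin d) (Fin d) F} (hM : M ∈ Matrix.orthogonalGroup (Fin d) F)
    (v w : Fin d → F) : M.mulVec v ⬝ᵥ M.mulVec w = v ⬝ᵥ w := by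
  rw [Matrix.dotProduct_mulVec, ← Matrix.mulVec_transpose, Matrix.mulVec_mulVec,
    (Matrix.mem_orthogonalGroup_iff' _ _).1 hM, Matrix.one_mulVec]

open scoped Classical in
/-- The orthogonal matrices that fix every vector of `V`. -/
noncomputable def orthogonalFixing {F : Type*} [Field F] [Fintype F] {d : ℕ}
    (V : Submodule F (Fin d → F)) : Finset (Matrix (Fin d) (Fin d) F) :=
  {M ∈ orthogonalFinset F d | ∀ v ∈ V, M.mulVec v = v}

/-- Orbit–stabiliser for `M ↦ M x`: the orbit lies in the quadric of `card_same_dotProducts_le`, and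
each nonempty fibre is a translate of the smaller stabiliser. -/
theorem card_orthogonalFixing_le {F : Type*} [Field F] [Fintype F] (h2 : (2 : F) ≠ 0) {d : ℕ}
    {V : Submodule F (Fin d → F)} {x : Fin d → F} (hx : x ∉ V) :
    #(orthogonalFixing V) * Fintype.card F ^ (finrank F V + 1) ≤
      2 * Fintype.card F ^ d * #(orthogonalFixing (V ⊔ Submodule.span F {x})) := by
  classical
  have h := card_same_dotProducts_le h2 hx
  have h' : #(orthogonalFixing V) ≤ #(orthogonalFixing (V ⊔ Submodule.span F {x})) *
      #{y : Fin d → F | (∀ v ∈ V, v ⬝ᵥ y = v ⬝ᵥ x) ∧ y ⬝ᵥ y = x ⬝ᵥ x} := by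
    refine card_le_mul_card_image_of_maps_to (f := fun M => M.mulVec x) (fun M hM => ?_) _
      (fun y _ => ?_)
    · simp only [orthogonalFixing, mem_filter, mem_orthogonalFinset, mem_univ, true_and] at hM ⊢
      refine ⟨fun v hv => ?_, dotProduct_mulVec_mulVec_of_mem_orthogonalGroup hM.1 _ _⟩
      rw [← dotProduct_mulVec_mulVec_of_mem_orthogonalGroup hM.1 v x, hM.2 v hv]
    · rcases Finset.eq_empty_or_nonempty {M ∈ orthogonalFixing V | M.mulVec x = y} with he | ⟨N, hN⟩
      · rw [he]; simp
      simp only [orthogonalFixing, mem_filter, mem_orthogonalFinset] at hN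
      obtain ⟨⟨hN1, hN2⟩, hN3⟩ := hN
      have e1 := (Matrix.mem_orthogonalGroup_iff' _ _).1 hN1
      have e2 := (Matrix.mem_orthogonalGroup_iff _ _).1 hN1
      have hNt : N.transpose ∈ Matrix.orthogonalGroup (Fin d) F :=
        (Matrix.mem_orthogonalGroup_iff _ _).2 (by rwa [Matrix.transpose_transpose])
      refine card_le_card_of_injOn (fun M => N.transpose * M) (fun M hM => ?_)
        (fun A _ B _ hAB => ?_)
      · simp only [orthogonalFixing, coe_filter, mem_filter, mem_orthogonalFinset,
          Set.mem_ofPred_eq] at hM ⊢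
        obtain ⟨⟨hM1, hM2⟩, hM3⟩ := hM
        refine ⟨mul_mem hNt hM1, fun v hv => ?_⟩
        obtain ⟨a, ha, b, hb, rfl⟩ := Submodule.mem_sup.1 hv
        obtain ⟨t, rfl⟩ := Submodule.mem_span_singleton.1 hb
        rw [← Matrix.mulVec_mulVec, Matrix.mulVec_add, Matrix.mulVec_smul, hM2 a ha, hM3,
          ← hN2 a ha, ← hN3, ← Matrix.mulVec_smul, ← Matrix.mulVec_add, Matrix.mulVec_mulVec, e1,
          Matrix.one_mulVec, hN2 a ha]
      · have := congrArg (fun C => N * C) hAB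
        simpa only [← mul_assoc, e2, one_mul] using this
  calc _ ≤ #(orthogonalFixing (V ⊔ Submodule.span F {x})) *
      #{y : Fin d → F | (∀ v ∈ V, v ⬝ᵥ y = v ⬝ᵥ x) ∧ y ⬝ᵥ y = x ⬝ᵥ x} *
      Fintype.card F ^ (finrank F V + 1) := by gcongr
    _ ≤ #(orthogonalFixing (V ⊔ Submodule.span F {x})) * (2 * Fintype.card F ^ d) := by
      rw [mul_assoc]; gcongr
    _ = _ := by ring

/-- Adding the `i`-th dimension costs a factor `2 q^(d - i)`; the exponents `1 + ⋯ + r` sum to the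
binomial coefficient. -/
theorem card_orthogonalFinset_mul_le {F : Type*} [Field F] [Fintype F] (h2 : (2 : F) ≠ 0) {d : ℕ}
    (V : Submodule F (Fin d → F)) :
    #(orthogonalFinset F d) * Fintype.card F ^ (finrank F V + 1).choose 2 ≤
      2 ^ finrank F V * Fintype.card F ^ (finrank F V * d) * #(orthogonalFixing V) := by
  classical
  obtain ⟨s, rfl⟩ : V.FG := IsNoetherian.noetherian V
  induction s using Finset.induction with
  | empty => rw [coe_empty, Submodule.span_empty]; simp [orthogonalFixing]
  | insert x s _ ih =>
    rw [coe_insert, Submodule.span_insert, sup_comm]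
    by_cases hx : x ∈ Submodule.span F (s : Set (Fin d → F))
    · rwa [sup_eq_left.2 (by simpa using hx)]
    · have h := card_orthogonalFixing_le h2 hx
      rw [Submodule.finrank_sup_span_singleton hx]
      set r := finrank F (Submodule.span F (s : Set (Fin d → F)))
      set q := Fintype.card F
      have hc : (r + 1 + 1).choose 2 = (r + 1).choose 2 + (r + 1) := by
        rw [Nat.choose_succ_succ' (r + 1) 1, Nat.choose_one_right, add_comm]
      rw [hc, pow_add, ← mul_assoc]
      calc _ ≤ 2 ^ r * q ^ (r * d) * #(orthogonalFixing (Submodule.span F (s : Set (Fin d → F))))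
            * q ^ (r + 1) := by gcongr
        _ ≤ 2 ^ r * q ^ (r * d) * (2 * q ^ d *
          #(orthogonalFixing (Submodule.span F (s : Set (Fin d → F)) ⊔ Submodule.span F {x}))) := by
          rw [mul_assoc]; gcongr
        _ = _ := by ring

/-- Covers degenerate simplices: passing from `r` to `r + 1` only weakens the bound, since `r + 1 ≤
d`. -/
theorem card_orthogonalFinset_mul_le_of_finrank_le {F : Type*} [Field F] [Fintype F]
    (h2 : (2 : F) ≠ 0) {d k : ℕ} (hkd : k ≤ d) (V : Submodule F (Fin d → F))
    (hV : finrank F V ≤ k) :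
    #(orthogonalFinset F d) * Fintype.card F ^ (k + 1).choose 2 ≤
      2 ^ k * Fintype.card F ^ (k * d) * #(orthogonalFixing V) := by
  induction k, hV using Nat.le_induction with
  | base => exact card_orthogonalFinset_mul_le h2 V
  | succ r _ ih =>
    have ih := ih (by omega)
    set q := Fintype.card F
    have hq : 1 ≤ q := Fintype.card_pos
    have hc : (r + 1 + 1).choose 2 = (r + 1).choose 2 + (r + 1) := by
      rw [Nat.choose_succ_succ' (r + 1) 1, Nat.choose_one_right, add_comm]
    rw [hc, pow_add, ← mul_assoc]
    calc _ ≤ 2 ^ r * q ^ (r * d) * #(orthogonalFixing V) * q ^ d := by gcongr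
      _ ≤ 2 ^ r * q ^ (r * d) * #(orthogonalFixing V) * q ^ d * 2 :=
        Nat.le_mul_of_pos_right _ two_pos
      _ = _ := by ring

/-! ### Congruent pairs and isometries -/

-- Cauchy–Schwarz: the class sizes sum to `#E ^ (k + 1)` and their squares to the number of
-- congruent pairs.
open scoped Classical in
theorem sq_card_le_ncard_simplexClasses_mul {F : Type*} [Field F] [Fintype F] {d : ℕ} (k : ℕ)
    (E : Finset (Fin d → F)) :
    #E ^ (2 * (k + 1)) ≤ (simplexClasses k E).ncard *
      #{p ∈ Fintype.piFinset (fun _ : Fin (k + 1) => E) ×ˢ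
        Fintype.piFinset (fun _ : Fin (k + 1) => E) | Congruent p.1 p.2} := by
  set S := Fintype.piFinset (fun _ : Fin (k + 1) => E) with hS
  set f : (Fin (k + 1) → Fin d → F) → Quotient (congruentSetoid F d k) := Quotient.mk _ with hf
  have hfeq : ∀ x y, f x = f y ↔ Congruent x y := fun x y => Quotient.eq
  have hT : (simplexClasses k E).ncard = #(S.image f) := by
    rw [← Set.ncard_coe_finset, coe_image]
    congr 2
    ext x
    simp only [simplexClasses, hS, Set.mem_image, mem_coe, Fintype.mem_piFinset, hf]
    rfl
  have hScard : #S = #E ^ (k + 1) := by rw [hS, Fintype.card_piFinset_const]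
  have h1 : #S = ∑ c ∈ S.image f, #{x ∈ S | f x = c} :=
    card_eq_sum_card_image f S
  have h3 : #{p ∈ S ×ˢ S | Congruent p.1 p.2} = ∑ c ∈ S.image f, #{x ∈ S | f x = c} ^ 2 := by
    rw [card_eq_sum_card_fiberwise (f := fun p => f p.1) (t := S.image f)]
    · refine sum_congr rfl fun c _ => ?_
      rw [sq, ← card_product]
      congr 1
      ext p
      simp only [mem_filter, mem_product, ← hfeq]
      constructor
      · rintro ⟨⟨⟨a, b⟩, e⟩, g⟩
        exact ⟨⟨a, g⟩, b, e ▸ g⟩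
      · rintro ⟨⟨a, g⟩, b, e⟩
        exact ⟨⟨⟨a, b⟩, g.trans e.symm⟩, g⟩
    · intro p hp
      simp only [coe_filter, mem_product, Set.mem_ofPred_eq] at hp
      exact mem_coe.2 (mem_image_of_mem f hp.1.1)
  rw [hT, h3, mul_comm 2, pow_mul, ← hScard, h1]
  exact sq_sum_le_card_mul_sum_sq

open scoped Classical in
/-- The number of points of `E` that the isometry `v ↦ M v + z` takes into `E`. -/
noncomputable def isometryCount {F : Type*} [Field F] {d : ℕ} (E : Finset (Fin d → F))
    (M : Matrix (Fin d) (Fin d) F) (z : Fin d → F) : ℕ :=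
  #{v ∈ E | M.mulVec v + z ∈ E}

theorem isometryCount_le {F : Type*} [Field F] {d : ℕ} (E : Finset (Fin d → F))
    (M : Matrix (Fin d) (Fin d) F) (z : Fin d → F) : isometryCount E M z ≤ #E :=
  open scoped Classical in card_filter_le _ _

-- Precompose one isometry from `x` to `y` with those fixing `x`: a matrix fixing all differences of
-- vertices extends to one by a suitable translation.
open scoped Classical in
theorem card_orthogonalFixing_vectorSpan_le {F : Type*} [Field F] [Fintype F] {d k : ℕ}
    {x y : Fin (k + 1) → Fin d → F} (h : Congruent x y) :
    #(orthogonalFixing (vectorSpan F (Set.range x))) ≤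
      #{g ∈ orthogonalFinset F d ×ˢ (univ : Finset (Fin d → F)) |
        ∀ i, g.1.mulVec (x i) + g.2 = y i} := by
  obtain ⟨N, hN, w, hw⟩ := h
  have hNt : N.transpose * N = 1 := (Matrix.mem_orthogonalGroup_iff' _ _).1 hN
  refine card_le_card_of_injOn
    (fun M => (N * M, w + N.mulVec (x 0) - N.mulVec (M.mulVec (x 0)))) (fun M hM => ?_)
    (fun A _ B _ hAB => ?_)
  · simp only [orthogonalFixing, coe_filter, mem_orthogonalFinset, mem_product, mem_univ,
      and_true, Set.mem_ofPred_eq] at hM ⊢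
    refine ⟨mul_mem hN hM.1, fun i => ?_⟩
    have := hM.2 (x i -ᵥ x 0) (vsub_mem_vectorSpan F (Set.mem_range_self i) (Set.mem_range_self 0))
    rw [vsub_eq_sub, Matrix.mulVec_sub, sub_eq_iff_eq_add] at this
    rw [← Matrix.mulVec_mulVec, this, ← hw i]
    simp only [Matrix.mulVec_add, Matrix.mulVec_sub]
    abel
  · have := congrArg (fun C => N.transpose * C) (Prod.ext_iff.1 hAB).1
    simpa only [← mul_assoc, hNt, one_mul] using this

-- Double counting of congruent pairs with an isometry between them; given the isometry, the first
-- simplex determines the second.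
open scoped Classical in
theorem card_congruent_mul_le {F : Type*} [Field F] [Fintype F] (h2 : (2 : F) ≠ 0) {d k : ℕ}
    (hkd : k ≤ d) (E : Finset (Fin d → F)) :
    #{p ∈ Fintype.piFinset (fun _ : Fin (k + 1) => E) ×ˢ
        Fintype.piFinset (fun _ : Fin (k + 1) => E) | Congruent p.1 p.2} *
      (#(orthogonalFinset F d) * Fintype.card F ^ (k + 1).choose 2) ≤
    2 ^ k * Fintype.card F ^ (k * d) *
      ∑ M ∈ orthogonalFinset F d, ∑ z, isometryCount E M z ^ (k + 1) := by
  set S := Fintype.piFinset (fun _ : Fin (k + 1) => E) with hS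
  set G := orthogonalFinset F d ×ˢ (univ : Finset (Fin d → F)) with hG
  set r : (Fin (k + 1) → Fin d → F) × (Fin (k + 1) → Fin d → F) →
    Matrix (Fin d) (Fin d) F × (Fin d → F) → Prop :=
    fun p g => ∀ i, g.1.mulVec (p.1 i) + g.2 = p.2 i with hr
  have hp : ∀ p ∈ ({p ∈ S ×ˢ S | Congruent p.1 p.2} : Finset _),
      #(orthogonalFinset F d) * Fintype.card F ^ (k + 1).choose 2 ≤
        2 ^ k * Fintype.card F ^ (k * d) * #{g ∈ G | r p g} := by
    intro p hp
    refine (card_orthogonalFinset_mul_le_of_finrank_le h2 hkd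
      (vectorSpan F (Set.range p.1)) (finrank_vectorSpan_range_le F p.1 (by simp))).trans ?_
    gcongr
    exact card_orthogonalFixing_vectorSpan_le (mem_filter.1 hp).2
  have hg : ∀ g ∈ G, #{p ∈ S ×ˢ S | r p g} ≤ isometryCount E g.1 g.2 ^ (k + 1) := by
    intro g _
    rw [isometryCount, ← Fintype.card_piFinset_const]
    refine card_le_card_of_injOn Prod.fst (fun p hp => ?_) (fun p hp p' hp' h => ?_)
    · simp only [hS, hr, coe_filter, mem_product, Fintype.mem_piFinset, Set.mem_ofPred_eq] at hp
      simp only [mem_coe, Fintype.mem_piFinset, mem_filter]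
      exact fun i => ⟨hp.1.1 i, (hp.2 i).symm ▸ hp.1.2 i⟩
    · simp only [hr, coe_filter, Set.mem_ofPred_eq] at hp hp'
      refine Prod.ext h (funext fun i => ?_)
      rw [← hp.2 i, ← hp'.2 i, h]
  calc _ = ∑ p ∈ S ×ˢ S with Congruent p.1 p.2,
        #(orthogonalFinset F d) * Fintype.card F ^ (k + 1).choose 2 := by
        rw [sum_const, smul_eq_mul]
    _ ≤ ∑ p ∈ S ×ˢ S with Congruent p.1 p.2,
        2 ^ k * Fintype.card F ^ (k * d) * #{g ∈ G | r p g} := sum_le_sum hp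
    _ ≤ ∑ p ∈ S ×ˢ S, 2 ^ k * Fintype.card F ^ (k * d) * #{g ∈ G | r p g} :=
        sum_le_sum_of_subset (filter_subset _ _)
    _ = 2 ^ k * Fintype.card F ^ (k * d) * ∑ g ∈ G, #{p ∈ S ×ˢ S | r p g} := by
        rw [← mul_sum]
        congr 1
        exact sum_card_bipartiteAbove_eq_sum_card_bipartiteBelow r
    _ ≤ 2 ^ k * Fintype.card F ^ (k * d) * ∑ g ∈ G, isometryCount E g.1 g.2 ^ (k + 1) := by
        gcongr with g hg'
        exact hg g hg'
    _ = _ := by rw [hG, sum_product]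

/-! ### Fourier analysis of the isometry counts -/

theorem sum_addChar_dotProduct {F : Type*} [Field F] [Fintype F] [DecidableEq F] {d : ℕ}
    {χ : AddChar F ℂ} (hχ : χ ≠ 1) (w : Fin d → F) :
    ∑ ξ : Fin d → F, χ (ξ ⬝ᵥ w) = if w = 0 then (Fintype.card F : ℂ) ^ d else 0 := by
  classical
  set φ : AddChar (Fin d → F) ℂ := χ.compAddMonoidHom
    (AddMonoidHom.mk' (fun ξ : Fin d → F => ξ ⬝ᵥ w) (fun a b => add_dotProduct a b w)) with hφ
  have hφa : ∀ ξ, φ ξ = χ (ξ ⬝ᵥ w) := fun ξ => rfl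
  have hφ0 : φ = 0 ↔ w = 0 := by
    constructor
    · intro h
      by_contra hw
      obtain ⟨i, hi⟩ := Function.ne_iff.1 hw
      obtain ⟨a, ha⟩ := AddChar.ne_one_iff.1 hχ
      have h1 := hφa (Pi.single i (a / w i))
      rw [single_dotProduct, div_mul_cancel₀ _ hi, h] at h1
      exact ha h1.symm
    · rintro rfl
      ext ξ
      simp [hφa]
  have h := φ.sum_eq_ite
  simp only [hφa, hφ0] at h
  rw [h]
  simp

theorem sum_norm_sq_fourier {F : Type*} [Field F] [Fintype F] {d : ℕ}
    {χ : AddChar F ℂ} (hχ : χ ≠ 1) (f : (Fin d → F) → ℂ) :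
    ∑ ξ : Fin d → F, ‖∑ z, f z * χ (-(ξ ⬝ᵥ z))‖ ^ 2 =
      (Fintype.card F : ℝ) ^ d * ∑ z, ‖f z‖ ^ 2 := by
  classical
  have h : ∀ ξ : Fin d → F, ((‖∑ z, f z * χ (-(ξ ⬝ᵥ z))‖ ^ 2 : ℝ) : ℂ) =
      ∑ z, ∑ z', f z * conj (f z') * χ (ξ ⬝ᵥ (z' - z)) := by
    intro ξ
    rw [Complex.ofReal_pow, ← Complex.mul_conj', map_sum, sum_mul_sum]
    refine sum_congr rfl fun z _ => sum_congr rfl fun z' _ => ?_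
    rw [map_mul, ← AddChar.map_neg_eq_conj, neg_neg, dotProduct_sub, sub_eq_neg_add,
      AddChar.map_add_eq_mul]
    ring
  apply Complex.ofReal_injective
  rw [Complex.ofReal_sum]
  simp only [h]
  rw [sum_comm]
  push_cast
  rw [mul_sum]
  refine sum_congr rfl fun z _ => ?_
  rw [sum_comm]
  simp only [← mul_sum, sum_addChar_dotProduct hχ, sub_eq_zero, mul_ite, mul_zero]
  rw [sum_ite_eq' univ z, if_pos (mem_univ z), ← Complex.mul_conj']
  ring

theorem sum_isometryCount_mul {F : Type*} [Field F] [Fintype F] {d : ℕ}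
    (χ : AddChar F ℂ) (E : Finset (Fin d → F)) (M : Matrix (Fin d) (Fin d) F) (ξ : Fin d → F) :
    ∑ z, (isometryCount E M z : ℂ) * χ (-(ξ ⬝ᵥ z)) =
      (∑ w ∈ E, χ (-(ξ ⬝ᵥ w))) * conj (∑ v ∈ E, χ (-(M.transpose.mulVec ξ ⬝ᵥ v))) := by
  classical
  have h : ∀ z, (isometryCount E M z : ℂ) * χ (-(ξ ⬝ᵥ z)) =
      ∑ v ∈ E, if M.mulVec v + z ∈ E then χ (-(ξ ⬝ᵥ z)) else 0 := by
    intro z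
    rw [isometryCount, card_filter, Nat.cast_sum, sum_mul]
    refine sum_congr rfl fun v _ => ?_
    split_ifs <;> simp
  simp only [h]
  rw [sum_comm, map_sum, mul_comm, sum_mul_sum]
  refine sum_congr rfl fun v _ => ?_
  -- Substitute `w = M v + z`, so that the sum over `z` factors.
  rw [← (Equiv.subRight (M.mulVec v)).sum_comp]
  simp only [Equiv.subRight_apply, add_sub_cancel]
  rw [← sum_filter, filter_mem_eq_inter, univ_inter]
  refine sum_congr rfl fun w _ => ?_
  rw [← AddChar.map_neg_eq_conj, neg_neg, ← AddChar.map_add_eq_mul, dotProduct_sub,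
    Matrix.dotProduct_mulVec, Matrix.mulVec_transpose]
  congr 1
  ring

theorem sum_sq_isometryCount_sub_le {F : Type*} [Field F] [Fintype F] [DecidableEq F] {d : ℕ}
    {χ : AddChar F ℂ} (hχ : χ ≠ 1) (E : Finset (Fin d → F)) {M : Matrix (Fin d) (Fin d) F}
    (hM : M ∈ Matrix.orthogonalGroup (Fin d) F) :
    (Fintype.card F : ℝ) ^ d *
      ∑ z, ((isometryCount E M z : ℝ) - (#E : ℝ) ^ 2 / (Fintype.card F : ℝ) ^ d) ^ 2 ≤
    ∑ ξ ∈ univ.filter (fun ξ : Fin d → F => ξ ≠ 0), ‖∑ w ∈ E, χ (-(ξ ⬝ᵥ w))‖ ^ 4 := by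
  set m : ℝ := (#E : ℝ) ^ 2 / (Fintype.card F : ℝ) ^ d with hm
  set e : (Fin d → F) → ℂ := fun ξ => ∑ w ∈ E, χ (-(ξ ⬝ᵥ w)) with he
  have hq : (Fintype.card F : ℂ) ^ d ≠ 0 := pow_ne_zero _ (Nat.cast_ne_zero.2 Fintype.card_ne_zero)
  -- Subtracting the mean `m` removes exactly the frequency `0`.
  have hf : ∀ ξ : Fin d → F, ∑ z, ((isometryCount E M z : ℂ) - m) * χ (-(ξ ⬝ᵥ z)) =
      if ξ ≠ 0 then e ξ * conj (e (M.transpose.mulVec ξ)) else 0 := by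
    intro ξ
    simp only [sub_mul, sum_sub_distrib]
    rw [sum_isometryCount_mul, ← mul_sum]
    have h0 : ∑ z : Fin d → F, χ (-(ξ ⬝ᵥ z)) =
        if ξ = 0 then (Fintype.card F : ℂ) ^ d else 0 := by
      have := sum_addChar_dotProduct hχ (-ξ)
      simp only [dotProduct_neg, neg_eq_zero] at this
      simpa only [dotProduct_comm ξ] using this
    rw [h0]
    by_cases hξ : ξ = 0
    · subst hξ
      simp only [hm, zero_dotProduct, Matrix.mulVec_zero, neg_zero, AddChar.map_zero_eq_one,
        sum_const, nsmul_eq_mul, mul_one, map_natCast, if_true, ne_eq, not_true, if_false]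
      push_cast
      field_simp
      ring
    · simp [hξ, he]
  have hnorm : ∀ z, ‖(isometryCount E M z : ℂ) - m‖ ^ 2 = ((isometryCount E M z : ℝ) - m) ^ 2 := by
    intro z
    rw [← Complex.ofReal_natCast, ← Complex.ofReal_sub, Complex.norm_real, Real.norm_eq_abs, sq_abs]
  have hP := sum_norm_sq_fourier hχ (fun z => (isometryCount E M z : ℂ) - m)
  simp only [hf, hnorm] at hP
  rw [← hP]
  have hMt : M * M.transpose = 1 := (Matrix.mem_orthogonalGroup_iff _ _).1 hM
  have hMt' : M.transpose * M = 1 := (Matrix.mem_orthogonalGroup_iff' _ _).1 hM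
  have hbij : ∑ ξ ∈ univ.filter (fun ξ : Fin d → F => ξ ≠ 0), ‖e (M.transpose.mulVec ξ)‖ ^ 4 =
      ∑ ξ ∈ univ.filter (fun ξ : Fin d → F => ξ ≠ 0), ‖e ξ‖ ^ 4 := by
    refine sum_nbij' (fun ξ => M.transpose.mulVec ξ) (fun ξ => M.mulVec ξ) ?_ ?_ ?_ ?_ ?_
    · intro ξ hξ
      simp only [mem_filter, mem_univ, true_and] at hξ ⊢
      intro h
      apply hξ
      rw [← Matrix.one_mulVec ξ, ← hMt, ← Matrix.mulVec_mulVec, h, Matrix.mulVec_zero]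
    · intro ξ hξ
      simp only [mem_filter, mem_univ, true_and] at hξ ⊢
      intro h
      apply hξ
      rw [← Matrix.one_mulVec ξ, ← hMt', ← Matrix.mulVec_mulVec, h, Matrix.mulVec_zero]
    · intro ξ _
      simp [hMt]
    · intro ξ _
      simp [hMt']
    · intro ξ _
      rfl
  calc ∑ ξ, ‖if ξ ≠ 0 then e ξ * conj (e (M.transpose.mulVec ξ)) else 0‖ ^ 2
      = ∑ ξ ∈ univ.filter (fun ξ : Fin d → F => ξ ≠ 0),
          ‖e ξ‖ ^ 2 * ‖e (M.transpose.mulVec ξ)‖ ^ 2 := by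
        rw [sum_filter]
        refine sum_congr rfl fun ξ _ => ?_
        split_ifs
        · rw [norm_mul, RCLike.norm_conj, mul_pow]
        · simp
    _ ≤ ∑ ξ ∈ univ.filter (fun ξ : Fin d → F => ξ ≠ 0),
          (‖e ξ‖ ^ 4 / 2 + ‖e (M.transpose.mulVec ξ)‖ ^ 4 / 2) := by
        refine sum_le_sum fun ξ _ => ?_
        nlinarith [sq_nonneg (‖e ξ‖ ^ 2 - ‖e (M.transpose.mulVec ξ)‖ ^ 2)]
    _ = _ := by
        rw [sum_add_distrib, ← sum_div, ← sum_div, hbij, add_halves]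

/-! ### Moments of Salem sets and the lower bound -/

theorem IsSalemWith.sum_norm_pow_four_le {F : Type*} [Field F] [Fintype F] [DecidableEq F] {d : ℕ}
    {χ : AddChar F ℂ} {s K : ℝ} {E : Finset (Fin d → F)} (h : IsSalemWith χ 4 s K E) :
    ∑ ξ ∈ univ.filter (fun ξ : Fin d → F => ξ ≠ 0), ‖∑ w ∈ E, χ (-(ξ ⬝ᵥ w))‖ ^ 4 ≤
      (Fintype.card F : ℝ) ^ d * (K ^ 4 * (#E : ℝ) ^ (4 - 4 * s)) := by
  have hq : 0 < (Fintype.card F : ℝ) ^ d := pow_pos (Nat.cast_pos.2 Fintype.card_pos) _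
  rw [IsSalemWith, fourierNorm] at h
  set Q : ℝ := (Fintype.card F : ℝ) ^ d with hQ
  have hS : ∑ ξ ∈ univ.filter (fun ξ : Fin d → F => ξ ≠ 0), ‖setFourier χ E ξ‖ ^ (4 : ℝ) =
      Q⁻¹ ^ 4 *
        ∑ ξ ∈ univ.filter (fun ξ : Fin d → F => ξ ≠ 0), ‖∑ w ∈ E, χ (-(ξ ⬝ᵥ w))‖ ^ 4 := by
    rw [mul_sum]
    refine sum_congr rfl fun ξ _ => ?_
    rw [setFourier, norm_mul, norm_inv, norm_pow, Complex.norm_natCast, ← mul_pow, ← hQ,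
      ← Real.rpow_natCast _ 4, Nat.cast_ofNat]
  rw [hS] at h
  set A := ∑ ξ ∈ univ.filter (fun ξ : Fin d → F => ξ ≠ 0), ‖∑ w ∈ E, χ (-(ξ ⬝ᵥ w))‖ ^ 4 with hA
  have hA0 : 0 ≤ A := sum_nonneg fun _ _ => by positivity
  have h4 := pow_le_pow_left₀ (by positivity) h 4
  rw [← Real.rpow_natCast, ← Real.rpow_mul (by positivity)] at h4
  norm_num at h4
  have hN : ((#E : ℝ) ^ (1 - s)) ^ 4 = (#E : ℝ) ^ (4 - 4 * s) := by
    rw [← Real.rpow_natCast, ← Real.rpow_mul (by positivity)]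
    congr 1
    push_cast
    ring
  rw [mul_pow, mul_pow, hN] at h4
  -- Four factors `Q` undo the normalization of `setFourier`, one that of the averaged norm.
  have : A = Q ^ 5 * (Q⁻¹ * (Q⁻¹ ^ 4 * A)) := by field_simp
  rw [this]
  calc _ ≤ Q ^ 5 * (K ^ 4 * ((Q ^ 4)⁻¹ * (#E : ℝ) ^ (4 - 4 * s))) :=
        mul_le_mul_of_nonneg_left (by simpa using h4) (by positivity)
    _ = Q ^ 5 * (Q ^ 4)⁻¹ * (K ^ 4 * (#E : ℝ) ^ (4 - 4 * s)) := by ring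
    _ = _ := by
        rw [pow_succ Q 4, mul_right_comm (Q ^ 4), mul_inv_cancel₀ (pow_pos hq 4).ne', one_mul]

theorem IsSalemWith.sum_isometryCount_pow_le {F : Type*} [Field F] [Fintype F] [DecidableEq F]
    {d k : ℕ} (hk : 1 ≤ k) {χ : AddChar F ℂ} (hχ : χ ≠ 1) {s K : ℝ} {E : Finset (Fin d → F)}
    (h : IsSalemWith χ 4 s K E) {M : Matrix (Fin d) (Fin d) F}
    (hM : M ∈ Matrix.orthogonalGroup (Fin d) F) :
    ((Fintype.card F : ℝ) ^ d) ^ k * ∑ z, (isometryCount E M z : ℝ) ^ (k + 1) ≤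
      2 ^ k * ((#E : ℝ) ^ (2 * (k + 1)) + ((Fintype.card F : ℝ) ^ d) ^ k *
        ((#E : ℝ) ^ (k - 1) * (K ^ 4 * (#E : ℝ) ^ (4 - 4 * s)))) := by
  have hQ : 0 < (Fintype.card F : ℝ) ^ d := pow_pos (Nat.cast_pos.2 Fintype.card_pos) _
  have hvar := (sum_sq_isometryCount_sub_le hχ E hM).trans h.sum_norm_pow_four_le
  have hEQ : (#E : ℝ) ≤ (Fintype.card F : ℝ) ^ d := by
    have := card_le_univ E
    rw [Fintype.card_pi, prod_const, card_univ, Fintype.card_fin] at this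
    exact_mod_cast this
  have huniv : (#(univ : Finset (Fin d → F)) : ℝ) = (Fintype.card F : ℝ) ^ d := by
    rw [card_univ, Fintype.card_pi, prod_const, card_univ, Fintype.card_fin]
    push_cast
    rfl
  set Q := (Fintype.card F : ℝ) ^ d
  set N := (#E : ℝ) with hN
  set m := N ^ 2 / Q with hm
  replace hvar := le_of_mul_le_mul_left hvar hQ
  have hN0 : 0 ≤ N := Nat.cast_nonneg _
  have hm0 : 0 ≤ m := by positivity
  have hmN : m ≤ N := by
    rw [hm, div_le_iff₀ hQ, sq]
    gcongr
  have hpt : ∀ z, (isometryCount E M z : ℝ) ^ (k + 1) ≤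
      2 ^ k * (m ^ (k + 1) + N ^ (k - 1) * ((isometryCount E M z : ℝ) - m) ^ 2) := by
    intro z
    set l := (isometryCount E M z : ℝ)
    have hl0 : 0 ≤ l := Nat.cast_nonneg _
    have hlN : l ≤ N := Nat.cast_le.2 (isometryCount_le E M z)
    -- Both `l` and `m` lie in `[0, N]`; this handles `k - 1` of the `k + 1` factors and leaves a
    -- square for the variance.
    have hab : |l - m| ≤ N := abs_le.2 ⟨by linarith, by linarith⟩
    calc l ^ (k + 1) ≤ (m + |l - m|) ^ (k + 1) := by
          gcongr
          linarith [le_abs_self (l - m)]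
      _ ≤ 2 ^ k * (m ^ (k + 1) + |l - m| ^ (k + 1)) := add_pow_le hm0 (abs_nonneg _) (k + 1)
      _ = 2 ^ k * (m ^ (k + 1) + |l - m| ^ (k - 1) * (l - m) ^ 2) := by
          rw [show k + 1 = k - 1 + 2 by omega, pow_add |l - m|, sq_abs]
      _ ≤ _ := by gcongr
  calc _ ≤ Q ^ k * ∑ z, 2 ^ k * (m ^ (k + 1) +
        N ^ (k - 1) * ((isometryCount E M z : ℝ) - m) ^ 2) := by
        gcongr with z
        exact hpt z
    _ = 2 ^ k * (Q ^ k * (Q * m ^ (k + 1)) +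
        Q ^ k * (N ^ (k - 1) * ∑ z, ((isometryCount E M z : ℝ) - m) ^ 2)) := by
        rw [← mul_sum, sum_add_distrib, ← mul_sum, sum_const, nsmul_eq_mul, huniv]
        ring
    _ ≤ 2 ^ k * (Q ^ k * (Q * m ^ (k + 1)) +
        Q ^ k * (N ^ (k - 1) * (K ^ 4 * N ^ (4 - 4 * s)))) := by gcongr
    _ = _ := by
        have : Q ^ k * (Q * m ^ (k + 1)) = N ^ (2 * (k + 1)) := by
          rw [hm, div_pow, ← pow_mul N, ← mul_assoc, ← pow_succ, mul_div_cancel₀ _ (by positivity)]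
        rw [this]

open scoped Classical in
theorem IsSalemWith.card_congruent_mul_le {F : Type*} [Field F] [Fintype F] [DecidableEq F]
    (h2 : (2 : F) ≠ 0) {d k : ℕ} (hk : 1 ≤ k) (hkd : k ≤ d) {χ : AddChar F ℂ} (hχ : χ ≠ 1)
    {s K : ℝ} {E : Finset (Fin d → F)} (h : IsSalemWith χ 4 s K E) :
    (#{p ∈ Fintype.piFinset (fun _ : Fin (k + 1) => E) ×ˢ
        Fintype.piFinset (fun _ : Fin (k + 1) => E) | Congruent p.1 p.2} : ℝ) *
      (Fintype.card F : ℝ) ^ (k + 1).choose 2 ≤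
    4 ^ k * ((#E : ℝ) ^ (2 * (k + 1)) + ((Fintype.card F : ℝ) ^ d) ^ k *
        ((#E : ℝ) ^ (k - 1) * (K ^ 4 * (#E : ℝ) ^ (4 - 4 * s)))) := by
  have h1 := FiniteFieldFourier.card_congruent_mul_le h2 hkd E
  set P := #{p ∈ Fintype.piFinset (fun _ : Fin (k + 1) => E) ×ˢ
        Fintype.piFinset (fun _ : Fin (k + 1) => E) | Congruent p.1 p.2}
  set R := (#E : ℝ) ^ (2 * (k + 1)) + ((Fintype.card F : ℝ) ^ d) ^ k *
        ((#E : ℝ) ^ (k - 1) * (K ^ 4 * (#E : ℝ) ^ (4 - 4 * s))) with hR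
  have ho : 0 < (#(orthogonalFinset F d) : ℝ) :=
    Nat.cast_pos.2 (card_pos.2 ⟨1, mem_orthogonalFinset.2 (one_mem _)⟩)
  have h1' : (P : ℝ) * (#(orthogonalFinset F d) * (Fintype.card F : ℝ) ^ (k + 1).choose 2) ≤
      2 ^ k * (Fintype.card F : ℝ) ^ (k * d) *
        ∑ M ∈ orthogonalFinset F d, ∑ z, (isometryCount E M z : ℝ) ^ (k + 1) := by
    exact_mod_cast h1
  refine le_of_mul_le_mul_left ?_ ho
  calc _ = (P : ℝ) * (#(orthogonalFinset F d) * (Fintype.card F : ℝ) ^ (k + 1).choose 2) := by ring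
    _ ≤ _ := h1'
    _ = 2 ^ k * ∑ M ∈ orthogonalFinset F d,
        ((Fintype.card F : ℝ) ^ d) ^ k * ∑ z, (isometryCount E M z : ℝ) ^ (k + 1) := by
        rw [← mul_sum, mul_comm k d, pow_mul, mul_assoc]
    _ ≤ 2 ^ k * ∑ M ∈ orthogonalFinset F d, 2 ^ k * R := by
        refine mul_le_mul_of_nonneg_left (sum_le_sum fun M hM => ?_) (by positivity)
        exact h.sum_isometryCount_pow_le hk hχ (mem_orthogonalFinset.1 hM)
    _ = _ := by
        rw [sum_const, nsmul_eq_mul, show (4 : ℝ) = 2 * 2 by norm_num, mul_pow]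
        ring

theorem IsSalemWith.min_le_ncard_simplexClasses {F : Type*} [Field F] [Fintype F] [DecidableEq F]
    (h2 : (2 : F) ≠ 0) {d k : ℕ} (hk : 1 ≤ k) (hkd : k ≤ d) {χ : AddChar F ℂ} (hχ : χ ≠ 1)
    {s K : ℝ} {E : Finset (Fin d → F)} (hE : E.Nonempty) (h : IsSalemWith χ 4 s K E) :
    min ((Fintype.card F : ℝ) ^ (k + 1).choose 2)
      ((#E : ℝ) ^ ((k : ℝ) - 1 + 4 * s) *
        (Fintype.card F : ℝ) ^ (((k + 1).choose 2 : ℝ) - (k : ℝ) * (d : ℝ))) ≤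
      4 ^ k * (1 + K ^ 4) * ((simplexClasses k E).ncard : ℝ) := by
  classical
  have hP := h.card_congruent_mul_le h2 hk hkd hχ
  have hT := sq_card_le_ncard_simplexClasses_mul k E
  set P := #{p ∈ Fintype.piFinset (fun _ : Fin (k + 1) => E) ×ˢ
        Fintype.piFinset (fun _ : Fin (k + 1) => E) | Congruent p.1 p.2}
  set T := (simplexClasses k E).ncard
  have hP0 : (0 : ℝ) < P := by
    have : 0 < T * P := (pow_pos hE.card_pos _).trans_le hT
    exact Nat.cast_pos.2 (Nat.pos_of_mul_pos_left this)
  have hT' : (#E : ℝ) ^ (2 * (k + 1)) ≤ T * P := by exact_mod_cast hT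
  have hq : 0 < (Fintype.card F : ℝ) := Nat.cast_pos.2 Fintype.card_pos
  have hN : 0 < (#E : ℝ) := Nat.cast_pos.2 hE.card_pos
  set q := (Fintype.card F : ℝ)
  set N := (#E : ℝ)
  set A := q ^ (k + 1).choose 2 with hA
  set X := N ^ ((k : ℝ) - 1 + 4 * s) * q ^ (((k + 1).choose 2 : ℝ) - (k : ℝ) * (d : ℝ)) with hX
  have hA0 : 0 < A := by positivity
  -- `X` is the value at which the variance term balances the main term.
  have hXA : X * ((q ^ d) ^ k * (N ^ (k - 1) * N ^ (4 - 4 * s))) = A * N ^ (2 * (k + 1)) := by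
    have e1 : q ^ (((k + 1).choose 2 : ℝ) - (k : ℝ) * (d : ℝ)) * (q ^ d) ^ k = A := by
      rw [← pow_mul, hA, ← Real.rpow_natCast q (d * k), ← Real.rpow_add hq,
        ← Real.rpow_natCast q ((k + 1).choose 2)]
      congr 1
      push_cast
      ring
    have e2 : N ^ ((k : ℝ) - 1 + 4 * s) * (N ^ (k - 1) * N ^ (4 - 4 * s)) = N ^ (2 * (k + 1)) := by
      rw [← Real.rpow_natCast N (k - 1), ← Real.rpow_add hN, ← Real.rpow_add hN,
        ← Real.rpow_natCast N (2 * (k + 1))]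
      congr 1
      push_cast [Nat.cast_sub hk]
      ring
    rw [hX, ← e1, ← e2]
    ring
  have hmin0 : 0 ≤ min A X := by positivity
  refine le_of_mul_le_mul_right (a := P * A) ?_ (by positivity)
  calc min A X * (P * A)
      ≤ min A X * (4 ^ k * (N ^ (2 * (k + 1)) + (q ^ d) ^ k *
        (N ^ (k - 1) * (K ^ 4 * N ^ (4 - 4 * s))))) := by gcongr
    _ = 4 ^ k * (min A X * N ^ (2 * (k + 1)) +
        K ^ 4 * (min A X * ((q ^ d) ^ k * (N ^ (k - 1) * N ^ (4 - 4 * s))))) := by ring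
    _ ≤ 4 ^ k * (A * N ^ (2 * (k + 1)) +
        K ^ 4 * (X * ((q ^ d) ^ k * (N ^ (k - 1) * N ^ (4 - 4 * s))))) := by
        gcongr
        · exact min_le_left _ _
        · exact min_le_right _ _
    _ = 4 ^ k * (1 + K ^ 4) * A * N ^ (2 * (k + 1)) := by rw [hXA]; ring
    _ ≤ 4 ^ k * (1 + K ^ 4) * A * (T * P) := by gcongr
    _ = _ := by ring

theorem two_ne_zero_of_odd_card {F : Type*} [Field F] [Fintype F] (h : Odd (Fintype.card F)) :
    (2 : F) ≠ 0 := by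
  refine Ring.two_ne_zero fun h2 => ?_
  have := FiniteField.even_card_iff_char_two.1 h2
  have := Nat.odd_iff.1 h
  omega

end FiniteFieldFourier

theorem theorem9p3 (d k : ℕ) (hk : 1 ≤ k) (hkd : k ≤ d) :
    (∀ s : ℝ, 0 ≤ s → s ≤ 1 → ∀ K : ℝ, 0 < K → ∃ c : ℝ, 0 < c ∧
      ∀ (F : Type u) [Field F] [Fintype F] [DecidableEq F], Odd (Fintype.card F) →
      ∀ χ : AddChar F ℂ, χ ≠ 1 →
      ∀ E : Finset (Fin d → F), E.Nonempty →
        FiniteFieldFourier.IsSalemWith χ 4 s K E →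
        c * min ((Fintype.card F : ℝ) ^ (k + 1).choose 2)
            ((E.card : ℝ) ^ ((k : ℝ) - 1 + 4 * s) *
              (Fintype.card F : ℝ) ^ (((k + 1).choose 2 : ℝ) - (k : ℝ) * (d : ℝ)))
          ≤ ((FiniteFieldFourier.simplexClasses k E).ncard : ℝ)) ∧
    (∀ a : ℝ, 0 < a → ∀ K : ℝ, 0 < K → ∃ c : ℝ, 0 < c ∧
      ∀ (F : Type u) [Field F] [Fintype F] [DecidableEq F], Odd (Fintype.card F) →
      ∀ χ : AddChar F ℂ, χ ≠ 1 →
      ∀ E : Finset (Fin d → F),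
        a * (Fintype.card F : ℝ) ^ (((k : ℝ) * (d : ℝ)) / ((k : ℝ) + 1)) ≤ (E.card : ℝ) →
        FiniteFieldFourier.IsSalemWith χ 4 (1 / 2) K E →
        c * (Fintype.card F : ℝ) ^ (k + 1).choose 2
          ≤ ((FiniteFieldFourier.simplexClasses k E).ncard : ℝ)) := by
  constructor
  · intro s _ _ K hK
    refine ⟨(4 ^ k * (1 + K ^ 4))⁻¹, by positivity, fun F _ _ _ hF χ hχ E hE h => ?_⟩
    rw [inv_mul_le_iff₀ (by positivity)]
    exact h.min_le_ncard_simplexClasses (FiniteFieldFourier.two_ne_zero_of_odd_card hF) hk hkd hχ hE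
  · intro a ha K hK
    refine ⟨(4 ^ k * (1 + K ^ 4))⁻¹ * min 1 (a ^ (k + 1)), by positivity,
      fun F _ _ _ hF χ hχ E hEa h => ?_⟩
    have hq : 0 < (Fintype.card F : ℝ) := Nat.cast_pos.2 Fintype.card_pos
    have hN : 0 < (E.card : ℝ) := lt_of_lt_of_le (by positivity) hEa
    have hE : E.Nonempty := Finset.card_pos.1 (Nat.cast_pos.1 hN)
    rw [mul_assoc, inv_mul_le_iff₀ (by positivity)]
    refine le_trans ?_ (h.min_le_ncard_simplexClasses
      (FiniteFieldFourier.two_ne_zero_of_odd_card hF) hk hkd hχ hE)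
    rw [min_mul_of_nonneg _ _ (by positivity), one_mul]
    refine min_le_min le_rfl ?_
    set q := (Fintype.card F : ℝ)
    -- At `s = 1/2` the power of `#E` is `k + 1`, so the size hypothesis contributes `a^(k+1)
    -- q^(kd)`, which cancels `q^(-kd)`.
    have e1 : (k : ℝ) - 1 + 4 * (1 / 2) = ((k + 1 : ℕ) : ℝ) := by push_cast; ring
    have e2 : (a * q ^ (((k : ℝ) * (d : ℝ)) / ((k : ℝ) + 1))) ^ (k + 1) =
        a ^ (k + 1) * q ^ ((k : ℝ) * (d : ℝ)) := by
      rw [mul_pow, ← Real.rpow_natCast (q ^ _), ← Real.rpow_mul hq.le]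
      congr 2
      push_cast
      field_simp
    rw [e1, Real.rpow_natCast]
    calc a ^ (k + 1) * q ^ (k + 1).choose 2
        = a ^ (k + 1) * q ^ ((k : ℝ) * (d : ℝ)) *
          q ^ (((k + 1).choose 2 : ℝ) - (k : ℝ) * (d : ℝ)) := by
          rw [mul_assoc, ← Real.rpow_add hq, add_sub_cancel, Real.rpow_natCast]
      _ ≤ _ := by
          rw [← e2]
          gcongr
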